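/- Let $d\ge 2$ and $p\in[0,1]$, and consider site percolation on $\mathbb Z^d=\mathbb Z^{d-1}\times\mathbb Z$: each site is independently open with probability $p$ and closed otherwise. Let $e_1,\dots,e_d$ be the standard basis vectors and $\Delta=\{-e_d+\sum_{i=1}^{d-1}\alpha_ie_i:\alpha_i\in\{-1,0,1\}\}$. A $\Lambda$-path is a finite sequence of sites $z(0),\dots,z(m)$ with $z(i+1)-z(i)\in\{e_d\}\cup\Delta$ for all $i<m$. For an integer $r\ge 0$ it is called $r$-open if, among the indices $i<m$ with $z(i+1)-z(i)=e_d$, the sites $z(i+1)$ are all distinct and at most $r$ of them are open. Write $y\xrightarrow{r}z$ if there is an $r$-open $\Lambda$-path from $y$ to $z$ (for $r<0$ this never holds). For $n\in\mathbb Z$ let $S_n=\{z: y\xrightarrow{r}z\text{ for some integer }r\ge 0\text{ and some }y\text{ with }y_d=2(n-r)\}$, and for $x\in\mathbb Z^{d-1}$ let $L_n(x)=\min\{\ell\in\mathbb Z:(x,\ell)\notin S_n\}$ (with $\min\emptyset=\infty$). A site $(x,2n+1)$ of odd height is good if $L_n(x)=2n+1$, and bad otherwise. For a site $y$ of even height (that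 is, $y_d$ even), the obstacle at $y$ is the random set $$A_y=\Bigl\{z\in\mathbb Z^d: z_d\text{ odd},\ y\xrightarrow{(z_d-y_d-1)/2}z\Bigr\}.$$ Let $(\tilde A_y)$, indexed by the sites $y$ of even height, be mutually independent random sets, with $\tilde A_y$ equal in law to $A_y$ for each $y$. Then the set of bad sites is equal to $\bigcup_yA_y$, and $\bigcup_yA_y$ is stochastically dominated by $\bigcup_y\tilde A_y$; that is, on some probability space there are random sets $B$ and $\tilde B$, equal in law to $\bigcup_yA_y$ and $\bigcup_y\tilde A_y$ respectively, such that $B\subseteq\tilde B$ almost surely. -/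

import Mathlib

open MeasureTheory ProbabilityTheory

noncomputable section

/-- The lattice `ℤ^d`, whose sites are written `(x, h)` with `x ∈ ℤ^(d-1)` and height `h ∈ ℤ`
(the last coordinate). -/
abbrev Site (d : ℕ) : Type := (Fin (d - 1) → ℤ) × ℤ

/-- A site percolation configuration: `σ x = true` means that `x` is open, `σ x = false` that
`x` is closed. -/
abbrev Config (d : ℕ) : Type := Site d → Bool

/-- The last standard basis vector `e_d`. -/
def upVec (d : ℕ) : Site d := (0, 1)

/-- The set `Δ` of the (possibly diagonal) down-steps `-e_d + ∑_{i<d} α_i e_i`, with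
`α_i ∈ {-1, 0, 1}`. -/
def downSteps (d : ℕ) : Set (Site d) :=
  {v | v.2 = -1 ∧ ∀ i, v.1 i = -1 ∨ v.1 i = 0 ∨ v.1 i = 1}

/-- `z 0, z 1, …, z m` is a `Λ`-path (the values of `z` beyond `m` play no role). -/
def IsLambdaPath {d : ℕ} (m : ℕ) (z : ℕ → Site d) : Prop :=
  ∀ i < m, z (i + 1) - z i = upVec d ∨ z (i + 1) - z i ∈ downSteps d

/-- The indices `i < m` of the up-steps of the sequence `z 0, …, z m`. -/
def upIndices {d : ℕ} (m : ℕ) (z : ℕ → Site d) : Finset ℕ :=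
  (Finset.range m).filter fun i => z (i + 1) - z i = upVec d

/-- The `Λ`-path `z 0, …, z m` is `r`-open: its up-steps end at distinct sites, and at most `r`
of these sites are open. -/
def IsROpenPath {d : ℕ} (σ : Config d) (r m : ℕ) (z : ℕ → Site d) : Prop :=
  IsLambdaPath m z ∧
    Set.InjOn (fun i => z (i + 1)) (upIndices m z : Set ℕ) ∧
    ((upIndices m z).filter fun i => σ (z (i + 1)) = true).card ≤ r

/-- There is an `r`-open `Λ`-path from `y` to `x`. -/
def ROpenReach {d : ℕ} (σ : Config d) (r : ℕ) (y x : Site d) : Prop :=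
  ∃ (m : ℕ) (z : ℕ → Site d), z 0 = y ∧ z m = x ∧ IsROpenPath σ r m z

/-- The set `S_n` of the sites that can be reached by an `r`-open `Λ`-path from a site of height
`2 (n - r)`, for some `r ≥ 0`. -/
def reachSet {d : ℕ} (σ : Config d) (n : ℤ) : Set (Site d) :=
  {z | ∃ (r : ℕ) (y : Site d), y.2 = 2 * (n - r) ∧ ROpenReach σ r y z}

/-- `L_n(x)`, the least `ℓ` with `(x, ℓ) ∉ S_n`, or `∞` if there is none. -/
def surface {d : ℕ} (σ : Config d) (n : ℤ) (x : Fin (d - 1) → ℤ) : WithTop ℤ :=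
  sInf ((fun ℓ : ℤ => (ℓ : WithTop ℤ)) '' {ℓ : ℤ | (x, ℓ) ∉ reachSet σ n})

/-- The bad sites: those sites `(x, 2n+1)` of odd height for which `L_n(x) ≠ 2n+1`. -/
def badSites {d : ℕ} (σ : Config d) : Set (Site d) :=
  {z | ∃ n : ℤ, z.2 = 2 * n + 1 ∧ surface σ n z.1 ≠ ((2 * n + 1 : ℤ) : WithTop ℤ)}

/-- The sites of even height. -/
abbrev EvenSite (d : ℕ) : Type := {y : Site d // Even y.2}

/-- The obstacle `A_y` at a site `y` of even height: the sites `z` of odd height that can be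
reached from `y` by an `r`-open `Λ`-path with `r = (z_d - y_d - 1) / 2`, where `r` has to be
non-negative. -/
def obstacle {d : ℕ} (σ : Config d) (y : EvenSite d) : Set (Site d) :=
  {z | Odd z.2 ∧ ∃ r : ℕ, 2 * (r : ℤ) = z.2 - y.1.2 - 1 ∧ ROpenReach σ r y.1 z}

universe u

/-- `Y` is stochastically dominated by `X`: there are `Y'`, `X'` on a common probability space,
equal in law to `Y` and `X` respectively, with `Y' ≤ X'` almost surely. For random sets
(`E = Set α`, with the product `σ`-algebra generated by the events `a ∈ ·`) the order is inclusion. -/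
def StochDominatedBy {E : Type u} [MeasurableSpace E] [Preorder E]
    {Ω₁ Ω₂ : Type*} [MeasurableSpace Ω₁] [MeasurableSpace Ω₂]
    (Y : Ω₁ → E) (μ₁ : Measure Ω₁) (X : Ω₂ → E) (μ₂ : Measure Ω₂) : Prop :=
  ∃ (Ω : Type u) (_ : MeasurableSpace Ω) (μ : Measure Ω) (Y' X' : Ω → E),
    IsProbabilityMeasure μ ∧ IdentDistrib Y' Y μ μ₁ ∧ IdentDistrib X' X μ μ₂ ∧
      ∀ᵐ ω ∂μ, Y' ω ≤ X' ω

end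

/-! A bad site is one reached within the budget fixed by its height and that of a starting point,
which gives the first claim almost at once. For domination, take finitely many starting points and
let them compete: infection `k` starts at `y k` at a time given by half its height. Then a site lies
in the union of obstacles iff it is infected before a deadline that depends on the site alone. An
up-step into `x` comes from `x - e_d`, so on fastest routes the state of `x` matters only to the
infection owning `x - e_d`. Given independent environments, look for a configuration `σ` whose state
at each `x` is the one seen by that owner in its own environment. In such a `σ` every first
infection is a walk in the owner's environment, so its obstacles are covered by the independent ones
(`iUnion_obstacle_subset`). Such a `σ` is unique (`OwnersSee.unique`). A fixed `v` prescribes its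
own owners, so it is a solution with exactly the probability of `v` (`measure_select_eq`). These
probabilities sum to one: a solution exists almost surely and has the right law, with no
step-by-step exploration (`exists_coupling_of_finite`). Finitely many random sites suffice for each
stage; compactness gives the limit (`stochDominatedBy_iUnion`). -/

/-- Walks in the environment `σ` that start at `y`, with their costs: an up-step costs `1` if it
ends at an open site, the other steps are free. -/
inductive Walk {d : ℕ} (σ : Config d) (y : Site d) : ℕ → Site d → Prop
  | refl : Walk σ y 0 y
  | down {r : ℕ} {w v : Site d} : Walk σ y r w → v ∈ downSteps d → Walk σ y r (w + v)
  | up {r : ℕ} {w : Site d} :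
      Walk σ y r w → Walk σ y (r + (σ (w + upVec d)).toNat) (w + upVec d)

namespace Walk

variable {d : ℕ} {σ σ' : Config d} {y z : Site d} {r : ℕ}

theorem exists_le_of_imp (h : Walk σ' y r z) (hσ : ∀ x, σ x = true → σ' x = true) :
    ∃ s ≤ r, Walk σ y s z := by
  induction h with
  | refl => exact ⟨0, le_rfl, .refl⟩
  | down _ hv ih =>
    obtain ⟨s, hs, h⟩ := ih
    exact ⟨s, hs, h.down hv⟩
  | @up r w _ ih =>
    obtain ⟨s, hs, h⟩ := ih
    refine ⟨_, add_le_add hs ?_, h.up⟩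
    have := hσ (w + upVec d)
    cases h1 : σ (w + upVec d) <;> simp_all

theorem exists_finset (h : Walk σ y r z) :
    ∃ S : Finset (Site d), ∀ σ' : Config d, (∀ x ∈ S, σ' x = σ x) → Walk σ' y r z := by
  classical
  induction h with
  | refl => exact ⟨∅, fun _ _ => .refl⟩
  | down _ hv ih =>
    obtain ⟨S, hS⟩ := ih
    exact ⟨S, fun σ' h => (hS σ' h).down hv⟩
  | @up r w _ ih =>
    obtain ⟨S, hS⟩ := ih
    refine ⟨insert (w + upVec d) S, fun σ' h => ?_⟩
    rw [← h _ (Finset.mem_insert_self _ _)]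
    exact (hS σ' fun x hx => h x (Finset.mem_insert_of_mem hx)).up

end Walk

/-! ### Open `Λ`-paths as walks with costs -/

section Paths

variable {d : ℕ} {σ : Config d} {y z : Site d} {r : ℕ}

theorem upVec_notMem_downSteps : upVec d ∉ downSteps d := by
  rintro ⟨h, -⟩
  simp [upVec] at h

/-- The number of up-steps of `z 0, …, z m` that end at an open site. -/
def openUpCount (σ : Config d) (m : ℕ) (z : ℕ → Site d) : ℕ :=
  ((upIndices m z).filter fun i => σ (z (i + 1)) = true).card

theorem openUpCount_eq_sum (m : ℕ) (z : ℕ → Site d) :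
    openUpCount σ m z = ∑ i ∈ Finset.range m,
      if z (i + 1) - z i = upVec d ∧ σ (z (i + 1)) = true then 1 else 0 := by
  rw [openUpCount, upIndices, Finset.filter_filter, Finset.card_filter]

theorem openUpCount_mono {m n : ℕ} (h : m ≤ n) (z : ℕ → Site d) :
    openUpCount σ m z ≤ openUpCount σ n z := by
  rw [openUpCount_eq_sum, openUpCount_eq_sum]
  exact Finset.sum_le_sum_of_subset (Finset.range_mono h)

theorem IsLambdaPath.walk {m : ℕ} {z : ℕ → Site d} (h : IsLambdaPath m z) :
    Walk σ (z 0) (openUpCount σ m z) (z m) := by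
  induction m with
  | zero => simpa [openUpCount_eq_sum] using Walk.refl
  | succ m ih =>
    have hw := ih fun i hi => h i (by omega)
    rw [openUpCount_eq_sum, Finset.sum_range_succ, ← openUpCount_eq_sum]
    have hz : z (m + 1) = z m + (z (m + 1) - z m) := by abel
    rcases h m (by omega) with hu | hd
    · have := hw.up
      rw [hu] at hz
      rw [← hz] at this
      convert this using 1
      cases σ (z (m + 1)) <;> simp [hu]
    · have := hw.down hd
      rw [← hz] at this
      have hne : z (m + 1) - z m ≠ upVec d := fun e => upVec_notMem_downSteps (e ▸ hd)
      simpa [hne] using this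

/-- Loop erasure: a self-avoiding `Λ`-path is extended by a step. -/
theorem exists_injOn_path_add {m : ℕ} {z : ℕ → Site d} (hz : IsLambdaPath m z)
    (hinj : Set.InjOn z (Set.Iic m)) {v : Site d} (hv : v = upVec d ∨ v ∈ downSteps d) :
    ∃ (n : ℕ) (z' : ℕ → Site d), z' 0 = z 0 ∧ z' n = z m + v ∧ IsLambdaPath n z' ∧
      Set.InjOn z' (Set.Iic n) ∧ openUpCount σ n z' ≤
        openUpCount σ m z + if v = upVec d ∧ σ (z m + v) = true then 1 else 0 := by
  -- If the new endpoint was already visited, the path is cut at that visit, which cannot raise the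
  -- cost.
  by_cases hmem : ∃ j ≤ m, z j = z m + v
  · obtain ⟨j, hj, e⟩ := hmem
    exact ⟨j, z, rfl, e, fun i hi => hz i (by omega), hinj.mono (Set.Iic_subset_Iic.2 hj),
      (openUpCount_mono hj z).trans (Nat.le_add_right _ _)⟩
  · push Not at hmem
    set z' : ℕ → Site d := fun i => if i ≤ m then z i else z m + v with hz'
    have h1 : ∀ i ≤ m, z' i = z i := fun i hi => if_pos hi
    have h2 : z' (m + 1) = z m + v := if_neg (by omega)
    refine ⟨m + 1, z', h1 0 (by omega), h2, fun i hi => ?_, ?_, ?_⟩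
    · rcases Nat.lt_succ_iff_lt_or_eq.1 hi with hi | rfl
      · rw [h1 _ (by omega), h1 _ hi.le]
        exact hz i hi
      · rw [h1 _ le_rfl, h2]
        simpa using hv
    · intro i hi j hj e
      simp only [Set.mem_Iic] at hi hj
      rcases Nat.lt_or_ge m i with hi' | hi' <;> rcases Nat.lt_or_ge m j with hj' | hj'
      · omega
      · obtain rfl : i = m + 1 := by omega
        rw [h2, h1 _ hj'] at e
        exact absurd e.symm (hmem j hj')
      · obtain rfl : j = m + 1 := by omega
        rw [h2, h1 _ hi'] at e
        exact absurd e (hmem i hi')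
      · rw [h1 _ hi', h1 _ hj'] at e
        exact hinj hi' hj' e
    · rw [openUpCount_eq_sum, Finset.sum_range_succ, h2, h1 m le_rfl, add_sub_cancel_left,
        openUpCount_eq_sum]
      refine add_le_add (Finset.sum_le_sum fun i hi => ?_) le_rfl
      have := Finset.mem_range.1 hi
      rw [h1 _ (by omega), h1 _ this.le]

theorem Walk.exists_injOn_path (h : Walk σ y r z) :
    ∃ (m : ℕ) (p : ℕ → Site d), p 0 = y ∧ p m = z ∧ IsLambdaPath m p ∧
      Set.InjOn p (Set.Iic m) ∧ openUpCount σ m p ≤ r := by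
  induction h with
  | refl =>
    exact ⟨0, fun _ => y, rfl, rfl, fun i hi => absurd hi (by omega),
      fun i hi j hj _ => by simp_all, by simp [openUpCount_eq_sum]⟩
  | @down r w v _ hv ih =>
    obtain ⟨m, p, h0, rfl, hp, hi, hc⟩ := ih
    obtain ⟨n, p', h0', hn, hp', hi', hc'⟩ := exists_injOn_path_add (σ := σ) hp hi (.inr hv)
    refine ⟨n, p', h0'.trans h0, hn, hp', hi', hc'.trans ?_⟩
    rw [if_neg fun e => upVec_notMem_downSteps (e.1 ▸ hv)]
    simpa using hc
  | @up r w _ ih =>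
    obtain ⟨m, p, h0, rfl, hp, hi, hc⟩ := ih
    obtain ⟨n, p', h0', hn, hp', hi', hc'⟩ := exists_injOn_path_add (σ := σ) hp hi (.inl rfl)
    refine ⟨n, p', h0'.trans h0, hn, hp', hi', hc'.trans (add_le_add hc ?_)⟩
    cases σ (p m + upVec d) <;> simp

/-- The distinctness condition on up-steps is harmless: loop erasure makes a walk self-avoiding at
no greater cost. -/
theorem rOpenReach_iff_exists_walk : ROpenReach σ r y z ↔ ∃ s ≤ r, Walk σ y s z := by
  constructor
  · rintro ⟨m, p, rfl, rfl, hp, -, hc⟩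
    exact ⟨_, hc, hp.walk⟩
  · rintro ⟨s, hs, h⟩
    obtain ⟨m, p, h0, hm, hp, hi, hc⟩ := h.exists_injOn_path
    refine ⟨m, p, h0, hm, hp, fun i hi' j hj' e => ?_, hc.trans hs⟩
    have hi'' : i < m := by simp_all [upIndices]
    have hj'' : j < m := by simp_all [upIndices]
    simpa using hi (Set.mem_Iic.2 (by omega : i + 1 ≤ m)) (Set.mem_Iic.2 (by omega : j + 1 ≤ m)) e

theorem mem_obstacle_iff {y : EvenSite d} :
    z ∈ obstacle σ y ↔ Odd z.2 ∧ ∃ s : ℕ, 2 * (s : ℤ) ≤ z.2 - y.1.2 - 1 ∧ Walk σ y.1 s z := by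
  simp only [obstacle, Set.mem_ofPred_eq, rOpenReach_iff_exists_walk]
  refine and_congr_right fun hz => ⟨?_, ?_⟩
  · rintro ⟨r, hr, s, hs, h⟩
    exact ⟨s, by omega, h⟩
  · rintro ⟨s, hs, h⟩
    obtain ⟨a, ha⟩ := hz
    obtain ⟨b, hb⟩ := y.2
    exact ⟨(a - b).toNat, by omega, s, by omega, h⟩

end Paths

/-! ### Bad sites and obstacles -/

section Surface

variable {d : ℕ} {σ : Config d} {n : ℤ}

theorem mem_reachSet_of_le {x : Fin (d - 1) → ℤ} {ℓ : ℤ} (h : ℓ ≤ 2 * n) :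
    (x, ℓ) ∈ reachSet σ n := by
  refine ⟨0, (x, 2 * n), by simp, rOpenReach_iff_exists_walk.2 ⟨0, le_rfl, ?_⟩⟩
  obtain ⟨k, hk⟩ := Int.le.dest h
  have : ∀ k : ℕ, Walk σ (x, 2 * n) 0 (x, 2 * n - k) := by
    intro k
    induction k with
    | zero => simpa using Walk.refl
    | succ k ih =>
      have := ih.down (v := (0, -1)) ⟨rfl, fun i => .inr (.inl rfl)⟩
      convert this using 1
      ext <;> simp
      ring
  convert this k using 2
  omega

/-- Straight descent from height `2n` with budget `0` puts every height up to `2n` in `S_n`, so `2n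
+ 1` is the least value the surface can take. -/
theorem surface_eq_iff {x : Fin (d - 1) → ℤ} :
    surface σ n x = ((2 * n + 1 : ℤ) : WithTop ℤ) ↔ (x, 2 * n + 1) ∉ reachSet σ n := by
  set s : Set ℤ := {ℓ : ℤ | (x, ℓ) ∉ reachSet σ n} with hs
  have hlb : 2 * n + 1 ∈ lowerBounds s := fun ℓ hℓ => by
    by_contra hlt
    exact hℓ (mem_reachSet_of_le (by omega))
  rw [surface, ← hs]
  rcases s.eq_empty_or_nonempty with he | hne
  · have hmem : 2 * n + 1 ∉ s := by simp [he]
    rw [he, Set.image_empty, WithTop.sInf_empty]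
    refine ⟨fun h => absurd h (WithTop.top_ne_coe), fun h => absurd h hmem⟩
  · rw [← WithTop.coe_sInf' hne ⟨_, hlb⟩, WithTop.coe_inj]
    refine ⟨fun h => ?_, fun h => ?_⟩
    · have := Int.csInf_mem hne ⟨_, hlb⟩
      rw [h] at this
      exact this
    · exact IsLeast.csInf_eq ⟨h, hlb⟩

theorem badSites_eq_iUnion_obstacle : badSites σ = ⋃ y : EvenSite d, obstacle σ y := by
  ext ⟨x, h⟩
  simp only [badSites, ne_eq, surface_eq_iff, not_not, Set.mem_ofPred_eq, Set.mem_iUnion]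
  constructor
  · rintro ⟨n, rfl, r, y, hy, hr⟩
    refine ⟨⟨y, ⟨n - r, by omega⟩⟩, ⟨n, rfl⟩, r, ?_, hr⟩
    simp only
    omega
  · rintro ⟨⟨y, a, ha⟩, ⟨n, hn⟩, r, hr, h'⟩
    simp only at hn hr
    subst hn
    exact ⟨n, rfl, r, y, by omega, h'⟩

end Surface

/-! ### Competing infections -/

section Competition

variable {d N : ℕ} {σ σ' : Config d} {y : Fin N → Site d} {c : Fin N → ℕ}

/-- Competing infections: infection `k` starts at the site `y k` at time `c k`. Times are multiplied
by `N` and `k` is added to them, so that the residue of a time modulo `N` is its infection and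
ties between the infections are broken. -/
inductive Infects (σ : Config d) (y : Fin N → Site d) (c : Fin N → ℕ) : ℕ → Site d → Prop
  | source (k : Fin N) : Infects σ y c (N * c k + k) (y k)
  | down {a : ℕ} {w v : Site d} : Infects σ y c a w → v ∈ downSteps d → Infects σ y c a (w + v)
  | up {a : ℕ} {w : Site d} :
      Infects σ y c a w → Infects σ y c (a + N * (σ (w + upVec d)).toNat) (w + upVec d)

/-- The first time at which a site is infected. -/
noncomputable def infectionTime (σ : Config d) (y : Fin N → Site d) (c : Fin N → ℕ)
    (w : Site d) : ℕ :=
  sInf {a | Infects σ y c a w}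

/-- The infection that reaches a site first. -/
noncomputable def owner [NeZero N] (σ : Config d) (y : Fin N → Site d) (c : Fin N → ℕ)
    (w : Site d) : Fin N :=
  Fin.ofNat N (infectionTime σ y c w)

/-- In the competition in the environment `σ`, the infection that reaches a site first
sees its own environment `u k` at the up-step from this site. -/
def OwnersSee [NeZero N] (u : Fin N → Config d) (y : Fin N → Site d) (c : Fin N → ℕ)
    (σ : Config d) : Prop :=
  ∀ x, u (owner σ y c (x - upVec d)) x = σ x

theorem Walk.infects {k : Fin N} {r : ℕ} {z : Site d} (h : Walk σ (y k) r z) :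
    Infects σ y c (N * (c k + r) + k) z := by
  induction h with
  | refl => exact .source k
  | down _ hv ih => exact ih.down hv
  | up _ ih =>
    convert ih.up using 1
    ring

theorem Infects.infectionTime_le {a : ℕ} {w : Site d} (h : Infects σ y c a w) :
    infectionTime σ y c w ≤ a :=
  Nat.sInf_le h

theorem Infects.infects_infectionTime {a : ℕ} {w : Site d} (h : Infects σ y c a w) :
    Infects σ y c (infectionTime σ y c w) w :=
  Nat.sInf_mem (s := {a | Infects σ y c a w}) ⟨a, h⟩

variable [NeZero N] {u : Fin N → Config d}

/-- Every initial piece of a fastest route is itself fastest. The residue of the time modulo `N` is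
constant along it, so a single infection owns all its sites, and each up-step shows the state in
that infection's own environment. -/
theorem Infects.exists_walk_of_eq_infectionTime (hu : OwnersSee u y c σ) {a : ℕ} {w : Site d}
    (h : Infects σ y c a w) (ha : infectionTime σ y c w = a) :
    ∃ (k : Fin N) (r : ℕ), a = N * (c k + r) + k ∧ Walk (u k) (y k) r w := by
  induction h with
  | source k => exact ⟨k, 0, rfl, .refl⟩
  | @down a w v h hv ih =>
    have h1 := h.infectionTime_le
    have h2 := (h.infects_infectionTime.down hv).infectionTime_le
    obtain ⟨k, r, e, hw⟩ := ih (by omega)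
    exact ⟨k, r, e, hw.down hv⟩
  | @up a w h ih =>
    have h1 := h.infectionTime_le
    have h2 := h.infects_infectionTime.up.infectionTime_le
    have h3 : infectionTime σ y c w = a := by omega
    obtain ⟨k, r, e, hw⟩ := ih h3
    have hk : owner σ y c w = k := by
      apply Fin.ext
      rw [owner, h3, e]
      simp [Nat.add_mod, Nat.mod_eq_of_lt k.2]
    have hx := hu (w + upVec d)
    rw [add_sub_cancel_right, hk] at hx
    refine ⟨k, _, ?_, hw.up⟩
    rw [e, hx]
    ring

theorem Walk.exists_walk_of_ownersSee (hu : OwnersSee u y c σ) {k : Fin N} {r : ℕ} {z : Site d}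
    (h : Walk σ (y k) r z) :
    ∃ (j : Fin N) (s : ℕ), c j + s ≤ c k + r ∧ Walk (u j) (y j) s z := by
  have h1 := h.infects (c := c)
  obtain ⟨j, s, e, hw⟩ := h1.infects_infectionTime.exists_walk_of_eq_infectionTime hu rfl
  have h2 := h1.infectionTime_le
  refine ⟨j, s, ?_, hw⟩
  -- The tie-breaking terms are less than `N`, so they cannot reverse a strict inequality between
  -- unscaled times.
  by_contra! hlt
  have := Nat.mul_le_mul_left N (Nat.succ_le_of_lt hlt)
  have := k.2
  rw [Nat.mul_succ] at *
  omega

/-- With these starting times the budget condition reads `2 (c k + s) ≤ z_d - 1 + 2 M`, a deadline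
common to all infections, so only the first arrival at `z` matters. -/
theorem iUnion_obstacle_subset {y : Fin N → EvenSite d} {M : ℤ}
    (hc : ∀ k, (y k).1.2 = 2 * ((c k : ℤ) - M)) (hu : OwnersSee u (fun k => (y k).1) c σ) :
    ⋃ k, obstacle σ (y k) ⊆ ⋃ k, obstacle (u k) (y k) := by
  intro z hz
  simp only [Set.mem_iUnion, mem_obstacle_iff] at hz ⊢
  obtain ⟨k, hodd, r, hr, hw⟩ := hz
  obtain ⟨j, s, hs, hw'⟩ := Walk.exists_walk_of_ownersSee (y := fun k => (y k).1) hu hw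
  refine ⟨j, hodd, s, ?_, hw'⟩
  have := hc k
  have := hc j
  omega

/-- Strong induction on time, with `σ` and `σ'` exchangeable in the hypothesis: an earlier arrival
in `σ'` would be one in `σ` too. Free steps leave the time unchanged, hence the inner induction
along the route. -/
theorem Infects.of_ownersSee (hu : OwnersSee u y c σ) (hu' : OwnersSee u y c σ') (a : ℕ)
    {w : Site d} (h : Infects σ y c a w) (ha : infectionTime σ y c w = a) :
    Infects σ' y c a w ∧ infectionTime σ' y c w = a := by
  induction a using Nat.strong_induction_on generalizing σ σ' w with
  | _ A IH =>
  have first : ∀ a ≤ A, ∀ w, infectionTime σ y c w = a → Infects σ' y c a w →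
      infectionTime σ' y c w = a := by
    intro a haA w ha h'
    by_contra hne
    have hlt : infectionTime σ' y c w < a := lt_of_le_of_ne h'.infectionTime_le hne
    have := (IH _ (hlt.trans_le haA) hu' hu h'.infects_infectionTime rfl).2
    omega
  suffices ∀ a w, Infects σ y c a w → a ≤ A → infectionTime σ y c w = a → Infects σ' y c a w from
    ⟨this A w h le_rfl ha, first A le_rfl w ha (this A w h le_rfl ha)⟩
  intro a w h haA ha
  induction h with
  | source k => exact .source k
  | @down a w v h hv ih =>
    have h1 := h.infectionTime_le
    have h2 := (h.infects_infectionTime.down hv).infectionTime_le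
    exact (ih haA (by omega)).down hv
  | @up a w h ih =>
    have h1 := h.infectionTime_le
    have h2 := h.infects_infectionTime.up.infectionTime_le
    have h3 : infectionTime σ y c w = a := by omega
    have h' := ih (by omega) h3
    have h4 := first a (by omega) w h3 h'
    have hx := hu (w + upVec d)
    have hx' := hu' (w + upVec d)
    rw [add_sub_cancel_right] at hx hx'
    have ho : owner σ y c w = owner σ' y c w := by rw [owner, owner, h3, h4]
    rw [ho, hx'] at hx
    rw [← hx]
    exact h'.up

theorem OwnersSee.unique (hu : OwnersSee u y c σ) (hu' : OwnersSee u y c σ') : σ = σ' := by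
  have key : ∀ w, infectionTime σ y c w = infectionTime σ' y c w := by
    intro w
    by_cases h : ∃ a, Infects σ y c a w
    · obtain ⟨a, h⟩ := h
      exact (h.infects_infectionTime.of_ownersSee hu hu' _ rfl).2.symm
    by_cases h' : ∃ a, Infects σ' y c a w
    · obtain ⟨a, h'⟩ := h'
      exact (h'.infects_infectionTime.of_ownersSee hu' hu _ rfl).2
    push Not at h h'
    -- A site never infected has default time `0` in both environments, so the owners agree there
    -- too.
    simp [infectionTime, h, h']
  funext x
  rw [← hu x, ← hu' x, owner, owner, key]

end Competition

/-! ### Limits of couplings, and couplings from disjoint events -/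

section Limit

open Filter Topology

theorem StochDominatedBy.congr {E : Type*} [MeasurableSpace E] [Preorder E]
    {Ω₁ Ω₂ Ω₃ Ω₄ : Type*} [MeasurableSpace Ω₁] [MeasurableSpace Ω₂] [MeasurableSpace Ω₃]
    [MeasurableSpace Ω₄] {Y : Ω₁ → E} {μ₁ : Measure Ω₁} {X : Ω₂ → E} {μ₂ : Measure Ω₂}
    {Y' : Ω₃ → E} {μ₃ : Measure Ω₃} {X' : Ω₄ → E} {μ₄ : Measure Ω₄}
    (h : StochDominatedBy Y μ₁ X μ₂) (hY : IdentDistrib Y Y' μ₁ μ₃)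
    (hX : IdentDistrib X X' μ₂ μ₄) : StochDominatedBy Y' μ₃ X' μ₄ := by
  obtain ⟨Ω, m, μ, Y₀, X₀, hμ, h1, h2, h3⟩ := h
  exact ⟨Ω, m, μ, Y₀, X₀, hμ, h1.trans hY, h2.trans hX, h3⟩

variable {α : Type*}

theorem measurableSet_superset (F : Finset α) : MeasurableSet {s : Set α | ↑F ⊆ s} := by
  have : {s : Set α | ↑F ⊆ s} = ⋂ a ∈ F, {s | a ∈ s} := by
    ext s
    simp [Set.subset_def]
  rw [this]
  exact F.measurableSet_biInter fun a _ => measurableSet_mem a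

/-- The law of a random set is determined by the probabilities that it contains the finite
sets. -/
theorem ext_of_measure_superset {μ ν : Measure (Set α)} [IsProbabilityMeasure μ]
    [IsProbabilityMeasure ν]
    (h : ∀ F : Finset α, μ {s | ↑F ⊆ s} = ν {s | ↑F ⊆ s}) : μ = ν := by
  classical
  refine ext_of_generate_finite (Set.range fun F : Finset α => {s : Set α | ↑F ⊆ s}) ?_ ?_ ?_
    (by simp)
  · refine le_antisymm ?_ (MeasurableSpace.generateFrom_le ?_)
    · refine iSup_le fun a => ?_
      rintro _ ⟨t, -, rfl⟩
      refine @measurable_to_prop _ (MeasurableSpace.generateFrom _) (fun s : Set α => a ∈ s) ?_ t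
        trivial
      refine MeasurableSpace.measurableSet_generateFrom ⟨{a}, ?_⟩
      ext s
      simp
    · rintro _ ⟨F, rfl⟩
      exact measurableSet_superset F
  · rintro _ ⟨F, rfl⟩ _ ⟨G, rfl⟩ -
    refine ⟨F ∪ G, ?_⟩
    ext s
    simp
  · rintro _ ⟨F, rfl⟩
    exact h F

/-- Stochastic domination passes to the limit of an increasing sequence of random sets. -/
theorem stochDominatedBy_iUnion [Countable α] {Ω₁ Ω₂ : Type*} [MeasurableSpace Ω₁]
    [MeasurableSpace Ω₂] {μ₁ : Measure Ω₁} [IsProbabilityMeasure μ₁] {μ₂ : Measure Ω₂}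
    [IsProbabilityMeasure μ₂] {B : ℕ → Ω₁ → Set α} (hB : ∀ n, Measurable (B n))
    (hmono : ∀ ω, Monotone fun n => B n ω) {C : ℕ → Ω₂ → Set α} (hC : ∀ n, Measurable (C n))
    (hlaw : ∀ n, μ₁.map (B n) = μ₂.map (C n)) {X : Ω₂ → Set α} (hX : Measurable X)
    (hCX : ∀ n, ∀ᵐ ω ∂μ₂, C n ω ⊆ X ω) :
    StochDominatedBy (fun ω => ⋃ n, B n ω) μ₁ X μ₂ := by
  classical
  let e : Set α → α → Bool := fun s a => decide (a ∈ s)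
  have he : Measurable e := measurable_pi_iff.2 fun a =>
    (Measurable.of_discrete (f := fun q : Prop => decide q)).comp (measurable_set_mem a)
  let e' : (α → Bool) → Set α := fun f => {a | f a = true}
  have he' : Measurable e' := measurable_set_iff.2 fun a => by
    exact (Measurable.of_discrete (f := fun b : Bool => b = true)).comp (measurable_pi_apply a)
  let J : ℕ → Ω₂ → (α → Bool) × (α → Bool) := fun n ω => (e (C n ω), e (X ω))
  have hJ : ∀ n, Measurable (J n) := fun n => (he.comp (hC n)).prodMk (he.comp hX)
  let ρ : ℕ → ProbabilityMeasure ((α → Bool) × (α → Bool)) := fun n =>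
    ⟨μ₂.map (J n), Measure.isProbabilityMeasure_map (hJ n).aemeasurable⟩
  -- The joint laws live on a compact space, so they converge along an ultrafilter. Cylinder events
  -- are clopen, so their probabilities converge as well.
  obtain ⟨ρ', hρ'⟩ : ∃ ρ', Tendsto ρ (hyperfilter ℕ) (𝓝 ρ') :=
    ⟨_, ((hyperfilter ℕ).map ρ).le_nhds_lim⟩
  have hclopen : ∀ {E : Set ((α → Bool) × (α → Bool))}, IsClopen E →
      Tendsto (fun n => μ₂ (J n ⁻¹' E)) (hyperfilter ℕ) (𝓝 ((ρ' : Measure _) E)) := by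
    intro E hE
    have h := ProbabilityMeasure.tendsto_measure_of_null_frontier_of_tendsto' hρ' (E := E)
      (by simp [hE.frontier_eq])
    refine h.congr fun n => ?_
    exact Measure.map_apply (hJ n) hE.1.measurableSet
  have hcyl : ∀ F : Finset α, IsClopen {f : α → Bool | ↑F ⊆ e' f} := by
    intro F
    have : {f : α → Bool | ↑F ⊆ e' f} = ⋂ a ∈ F, (fun f : α → Bool => f a) ⁻¹' {true} := by
      ext f
      simp [Set.subset_def, e']
    rw [this]
    exact isClopen_biInter_finset fun a _ => (isClopen_discrete _).preimage (continuous_apply a)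
  have hBU : Measurable fun ω => ⋃ n, B n ω := measurable_set_iff.2 fun a => by
    simp only [Set.mem_iUnion]
    exact Measurable.exists fun n => measurable_set_iff.1 (hB n) a
  have hee : ∀ s, e' (e s) = s := fun s => by ext a; simp [e, e']
  have prob1 := Measure.isProbabilityMeasure_map (μ := μ₁) hBU.aemeasurable
  have prob2 := Measure.isProbabilityMeasure_map (μ := μ₂) hX.aemeasurable
  have m1 : Measurable fun q : (α → Bool) × (α → Bool) => e' q.1 := he'.comp measurable_fst
  have m2 : Measurable fun q : (α → Bool) × (α → Bool) => e' q.2 := he'.comp measurable_snd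
  have prob3 := Measure.isProbabilityMeasure_map (μ := (ρ' : Measure _)) m1.aemeasurable
  have prob4 := Measure.isProbabilityMeasure_map (μ := (ρ' : Measure _)) m2.aemeasurable
  refine ⟨(α → Bool) × (α → Bool), inferInstance, ρ', fun q => e' q.1, fun q => e' q.2, inferInstance,
    ⟨m1.aemeasurable, hBU.aemeasurable, ext_of_measure_superset fun F => ?_⟩,
    ⟨m2.aemeasurable, hX.aemeasurable, ext_of_measure_superset fun F => ?_⟩, ?_⟩
  · rw [Measure.map_apply m1 (measurableSet_superset F),
      Measure.map_apply hBU (measurableSet_superset F)]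
    refine tendsto_nhds_unique (hclopen ((hcyl F).preimage continuous_fst)) ?_
    have hU : (fun ω => ⋃ n, B n ω) ⁻¹' {s | ↑F ⊆ s} = ⋃ n, B n ⁻¹' {s | ↑F ⊆ s} := by
      ext ω
      simp only [Set.mem_preimage, Set.mem_ofPred_eq, Set.mem_iUnion]
      exact ⟨Directed.exists_mem_subset_of_finset_subset_biUnion (hmono ω).directed_le,
        fun ⟨n, h⟩ => h.trans (Set.subset_iUnion (fun n => B n ω) n)⟩
    rw [hU]
    have hm : Monotone fun n => B n ⁻¹' {s | ↑F ⊆ s} := fun i j hij ω h =>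
      Set.Subset.trans h (hmono ω hij)
    refine ((tendsto_measure_iUnion_atTop hm).mono_left Nat.hyperfilter_le_atTop).congr fun n => ?_
    simp only [Function.comp_apply]
    rw [← Measure.map_apply (hB n) (measurableSet_superset F), hlaw,
      Measure.map_apply (hC n) (measurableSet_superset F)]
    congr 1
    ext ω
    simp [J, hee]
  · rw [Measure.map_apply m2 (measurableSet_superset F),
      Measure.map_apply hX (measurableSet_superset F)]
    refine tendsto_nhds_unique (hclopen ((hcyl F).preimage continuous_snd)) ?_
    refine tendsto_const_nhds.congr fun n => ?_
    congr 1
    ext ω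
    simp [J, hee]
  · have : ∀ᵐ q ∂(ρ' : Measure ((α → Bool) × (α → Bool))), ∀ a, ¬ (q.1 a = true ∧ q.2 a = false) := by
      refine ae_all_iff.2 fun a => ?_
      have hE : IsClopen {q : (α → Bool) × (α → Bool) | q.1 a = true ∧ q.2 a = false} :=
        ((isClopen_discrete {true}).preimage ((continuous_apply a).comp continuous_fst)).inter
          ((isClopen_discrete {false}).preimage ((continuous_apply a).comp continuous_snd))
      rw [ae_iff]
      simp only [not_not]
      refine tendsto_nhds_unique (hclopen hE) (tendsto_const_nhds.congr fun n => ?_)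
      symm
      refine measure_mono_null ?_ (ae_iff.1 (hCX n))
      intro ω hω h
      simp only [J, e, Set.mem_preimage, Set.mem_ofPred_eq, decide_eq_true_eq,
        decide_eq_false_iff_not] at hω
      exact hω.2 (h hω.1)
    filter_upwards [this] with q hq a ha
    have := hq a
    simp_all [e']

/-- Disjoint events whose probabilities are those of the values of a random variable are, up to a
null set, the events that a random variable of the same law takes these values. -/
theorem exists_map_eq_of_measure_eq {Ω V : Type*} [MeasurableSpace Ω] [MeasurableSpace V]
    [Countable V] [MeasurableSingletonClass V] {Q : Measure Ω} [IsProbabilityMeasure Q]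
    {P : Measure V} [IsProbabilityMeasure P] {E : V → Set Ω} (hE : ∀ v, MeasurableSet (E v))
    (hd : Pairwise (Function.onFun Disjoint E)) (h : ∀ v, Q (E v) = P {v}) :
    ∃ φ : Ω → V, Measurable φ ∧ Q.map φ = P ∧ ∀ᵐ ω ∂Q, ω ∈ E (φ ω) := by
  classical
  have hne : Nonempty V := by
    by_contra hV
    rw [not_nonempty_iff] at hV
    exact IsProbabilityMeasure.ne_zero P (Measure.eq_zero_of_isEmpty P)
  -- Disjointness and total mass one make the events cover almost everything.
  have hU : Q (⋃ v, E v) = 1 := by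
    rw [measure_iUnion hd hE]
    simp_rw [h]
    rw [← measure_iUnion (fun i j hij => by simpa [Function.onFun] using hij)
      (fun v => measurableSet_singleton v), Set.iUnion_of_singleton, measure_univ]
  have hae : ∀ᵐ ω ∂Q, ω ∈ ⋃ v, E v :=
    (prob_compl_eq_zero_iff (MeasurableSet.iUnion hE)).2 hU
  let v₀ : V := Classical.arbitrary V
  -- The uncovered null set goes to `v₀`, whose fibre is therefore measured through its complement.
  let φ : Ω → V := fun ω => if h : ∃ v, ω ∈ E v then h.choose else v₀
  have hφ : ∀ {ω v}, ω ∈ E v → φ ω = v := by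
    intro ω v hv
    have hex : ∃ v, ω ∈ E v := ⟨v, hv⟩
    have h1 : φ ω = hex.choose := dif_pos hex
    by_contra hne
    rw [h1] at hne
    exact Set.disjoint_left.1 (hd hne) hex.choose_spec hv
  have hpre : ∀ v, v ≠ v₀ → φ ⁻¹' {v} = E v := by
    intro v hv
    ext ω
    refine ⟨fun hω => ?_, hφ⟩
    by_cases hex : ∃ v, ω ∈ E v
    · obtain ⟨w, hw⟩ := hex
      have : φ ω = v := hω
      rwa [← this, hφ hw]
    · exact absurd (hω.symm.trans (dif_neg hex)) hv
  have hm : Measurable φ := by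
    refine measurable_to_countable' fun v => ?_
    by_cases hv : v = v₀
    · have : φ ⁻¹' {v} = (⋃ w : {w // w ≠ v₀}, E w)ᶜ := by
        ext ω
        simp only [Set.mem_preimage, Set.mem_singleton_iff, Set.mem_compl_iff, Set.mem_iUnion,
          not_exists]
        constructor
        · intro hω w hw
          exact w.2 ((hφ hw).symm.trans (hω.trans hv))
        · intro hω
          by_contra hne
          have h1 : ω ∈ φ ⁻¹' {φ ω} := rfl
          have h2 : φ ω ≠ v₀ := fun h' => hne (h'.trans hv.symm)
          rw [hpre _ h2] at h1
          exact hω ⟨_, h2⟩ h1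
      rw [this]
      exact (MeasurableSet.iUnion fun w => hE _).compl
    · rw [hpre v hv]
      exact hE v
  refine ⟨φ, hm, Measure.ext_of_singleton fun v => ?_, ?_⟩
  · rw [Measure.map_apply hm (measurableSet_singleton v), ← h v]
    refine measure_congr ?_
    filter_upwards [hae] with ω hω
    obtain ⟨w, hw⟩ := Set.mem_iUnion.1 hω
    refine propext ⟨fun hv => ?_, hφ⟩
    have : φ ω = v := hv
    rw [← this, hφ hw]
    exact hw
  · filter_upwards [hae] with ω hω
    obtain ⟨w, hw⟩ := Set.mem_iUnion.1 hω
    rwa [hφ hw]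

end Limit

/-! ### Reduction to finitely many random sites -/

section Truncation

open Classical in
/-- The configuration `σ`, with all sites outside `S` declared open. -/
noncomputable def openOutside {d : ℕ} (S : Finset (Site d)) (σ : Config d) : Config d :=
  fun x => if x ∈ S then σ x else true

variable {d : ℕ} {S T : Finset (Site d)} {σ : Config d}

theorem openOutside_of_mem {x : Site d} (h : x ∈ S) : openOutside S σ x = σ x := if_pos h

theorem openOutside_of_notMem {x : Site d} (h : x ∉ S) : openOutside S σ x = true := if_neg h

theorem obstacle_subset_of_imp {σ' : Config d} (h : ∀ x, σ x = true → σ' x = true)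
    (y : EvenSite d) : obstacle σ' y ⊆ obstacle σ y := by
  intro z hz
  rw [mem_obstacle_iff] at hz ⊢
  obtain ⟨hodd, s, hs, hw⟩ := hz
  obtain ⟨r, hr, hw'⟩ := hw.exists_le_of_imp h
  exact ⟨hodd, r, by omega, hw'⟩

/-- Open sites only add cost, so truncated obstacles grow with the set of sites left random. -/
theorem obstacle_openOutside_mono (h : S ⊆ T) (y : EvenSite d) :
    obstacle (openOutside S σ) y ⊆ obstacle (openOutside T σ) y := by
  refine obstacle_subset_of_imp (fun x hx => ?_) y
  by_cases hS : x ∈ S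
  · rwa [openOutside_of_mem hS, ← openOutside_of_mem (σ := σ) (h hS)]
  · exact openOutside_of_notMem hS

theorem obstacle_openOutside_subset (y : EvenSite d) :
    obstacle (openOutside S σ) y ⊆ obstacle σ y := by
  refine obstacle_subset_of_imp (fun x hx => ?_) y
  by_cases hS : x ∈ S
  · rwa [openOutside_of_mem hS]
  · exact openOutside_of_notMem hS

theorem exists_mem_obstacle_openOutside {y : EvenSite d} {z : Site d} (h : z ∈ obstacle σ y) :
    ∃ S : Finset (Site d), z ∈ obstacle (openOutside S σ) y := by
  obtain ⟨hodd, s, hs, hw⟩ := mem_obstacle_iff.1 h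
  obtain ⟨S, hS⟩ := hw.exists_finset
  exact ⟨S, mem_obstacle_iff.2 ⟨hodd, s, hs, hS _ fun x hx => openOutside_of_mem hx⟩⟩

open Classical in
/-- The extension of a configuration on `S` by open sites. -/
noncomputable def extendOpen (S : Finset (Site d)) (v : S → Bool) : Config d :=
  fun x => if h : x ∈ S then v ⟨x, h⟩ else true

theorem extendOpen_restrict : extendOpen S (fun x : S => σ x) = openOutside S σ := by
  funext x
  by_cases h : x ∈ S <;> simp [extendOpen, openOutside, h]

theorem extendOpen_apply (v : S → Bool) (x : S) : extendOpen S v x = v x := by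
  simp [extendOpen]

theorem extendOpen_injective : Function.Injective (extendOpen S) := fun v w h => by
  funext x
  rw [← extendOpen_apply v, h, extendOpen_apply]

theorem measurable_restrict_sites :
    Measurable fun (σ : Config d) (x : S) => σ x :=
  measurable_pi_iff.2 fun x => measurable_pi_apply (x : Site d)

/-- The function factors through the finite discrete space of configurations on `S`. -/
theorem measurable_openOutside_of_any {β : Type*} [MeasurableSpace β] (f : Config d → β) :
    Measurable fun σ : Config d => f (openOutside S σ) := by
  simp_rw [← extendOpen_restrict]
  exact (Measurable.of_discrete (f := fun v : S → Bool => f (extendOpen S v))).comp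
    measurable_restrict_sites

theorem measurable_obstacle (y : EvenSite d) :
    Measurable fun σ : Config d => obstacle σ y := by
  refine measurable_set_iff.2 fun z => ?_
  have : (fun σ : Config d => z ∈ obstacle σ y) =
      fun σ => ∃ S : Finset (Site d), z ∈ obstacle (openOutside S σ) y := by
    funext σ
    exact propext ⟨exists_mem_obstacle_openOutside,
      fun ⟨S, h⟩ => obstacle_openOutside_subset y h⟩
  rw [this]
  exact Measurable.exists fun S => measurable_openOutside_of_any fun σ => z ∈ obstacle σ y

end Truncation

theorem measurable_iUnion_set {α ι Ω : Type*} [Countable ι] [MeasurableSpace Ω]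
    {f : ι → Ω → Set α} (hf : ∀ i, Measurable (f i)) : Measurable fun ω => ⋃ i, f i ω :=
  measurable_set_iff.2 fun a => by
    simp only [Set.mem_iUnion]
    exact Measurable.exists fun i => measurable_set_iff.1 (hf i) a

/-! ### The coupling and the domination -/

section Domination

variable {d : ℕ} (β : Site d → Measure Bool) [∀ x, IsProbabilityMeasure (β x)]

/-- A configuration that takes the state of each site from a copy fixed in advance has the same
finite-dimensional probabilities as each of the independent copies. -/
theorem measure_select_eq {ι : Type*} (S : Finset (Site d)) (κ : Site d → ι) (v : Site d → Bool) :
    Measure.infinitePi (fun q : ι × Site d => β q.2) {U | ∀ x ∈ S, U (κ x, x) = v x} =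
      Measure.infinitePi β {σ | ∀ x ∈ S, σ x = v x} := by
  classical
  have h1 : {U : ι × Site d → Bool | ∀ x ∈ S, U (κ x, x) = v x} =
      Set.pi (S.image fun x => (κ x, x)) fun q => {v q.2} := by
    ext U
    simp [Set.mem_pi]
    aesop
  have h2 : {σ : Site d → Bool | ∀ x ∈ S, σ x = v x} = Set.pi S fun x => {v x} := by
    ext σ
    simp [Set.mem_pi]
  rw [h1, h2, Measure.infinitePi_pi _ (fun _ _ => measurableSet_singleton _),
    Measure.infinitePi_pi _ (fun _ _ => measurableSet_singleton _),
    Finset.prod_image (fun x _ x' _ h => (Prod.ext_iff.1 h).2)]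

/-- The events `E v` that `v` solves the owner equation are disjoint by uniqueness. Once `v` is
fixed its owners are deterministic, so `E v` prescribes one independent coordinate per site of `S`.
-/
theorem exists_coupling_of_finite (S : Finset (Site d)) {N : ℕ} [NeZero N]
    (y : Fin N → EvenSite d) :
    ∃ φ : (EvenSite d × Site d → Bool) → (S → Bool), Measurable φ ∧
      (Measure.infinitePi fun q : EvenSite d × Site d => β q.2).map φ =
        (Measure.infinitePi β).map (fun σ (x : S) => σ x) ∧
      ∀ᵐ U ∂Measure.infinitePi fun q : EvenSite d × Site d => β q.2,
        ⋃ k, obstacle (extendOpen S (φ U)) (y k) ⊆ ⋃ k, obstacle (fun x => U (y k, x)) (y k) := by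
  -- A common shift makes all starting times natural numbers.
  obtain ⟨M, hM⟩ : ∃ M : ℕ, ∀ k, 0 ≤ (y k).1.2 + 2 * M :=
    ⟨∑ k, (y k).1.2.natAbs, fun k => by
      have := Finset.single_le_sum (f := fun k => (y k).1.2.natAbs) (fun _ _ => Nat.zero_le _)
        (Finset.mem_univ k)
      omega⟩
  let c : Fin N → ℕ := fun k => ((y k).1.2 / 2 + M).toNat
  have hc : ∀ k, (y k).1.2 = 2 * ((c k : ℤ) - M) := fun k => by
    obtain ⟨a, ha⟩ := (y k).2
    have := hM k
    simp only [c]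
    omega
  let κ : (S → Bool) → Site d → Fin N := fun v x =>
    owner (extendOpen S v) (fun k => (y k).1) c (x - upVec d)
  let E : (S → Bool) → Set (EvenSite d × Site d → Bool) := fun v =>
    {U | ∀ x ∈ S, U (y (κ v x), x) = extendOpen S v x}
  -- Outside `S` all environments are open, so agreement on `S` suffices.
  have hsee : ∀ v U, U ∈ E v → OwnersSee (fun k => openOutside S fun x => U (y k, x))
      (fun k => (y k).1) c (extendOpen S v) := by
    intro v U hU x
    by_cases hx : x ∈ S
    · exact (openOutside_of_mem hx).trans (hU x hx)
    · exact (openOutside_of_notMem hx).trans (by simp [extendOpen, hx])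
  have hE : ∀ v, MeasurableSet (E v) := fun v => by
    have : E v = ⋂ x ∈ S, {U | U (y (κ v x), x) = extendOpen S v x} := by
      ext U
      simp [E]
    rw [this]
    exact S.measurableSet_biInter fun x _ =>
      measurableSet_eq_fun (measurable_pi_apply _) measurable_const
  have hd : Pairwise (Function.onFun Disjoint E) := fun v w hvw =>
    Set.disjoint_left.2 fun U hv hw =>
      hvw (extendOpen_injective ((hsee v U hv).unique (hsee w U hw)))
  have prob := Measure.isProbabilityMeasure_map (μ := Measure.infinitePi β)
    (measurable_restrict_sites (S := S)).aemeasurable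
  obtain ⟨φ, hφ, hmap, hae⟩ := exists_map_eq_of_measure_eq
    (P := (Measure.infinitePi β).map (fun σ (x : S) => σ x)) hE hd fun v => by
      rw [Measure.map_apply measurable_restrict_sites (measurableSet_singleton v)]
      refine (measure_select_eq β S (fun x => y (κ v x)) (extendOpen S v)).trans ?_
      congr 1
      ext σ
      simp only [Set.mem_ofPred_eq, Set.mem_preimage, Set.mem_singleton_iff, funext_iff,
        Subtype.forall]
      exact forall₂_congr fun x hx => by rw [extendOpen_apply v ⟨x, hx⟩]
  refine ⟨φ, hφ, hmap, ?_⟩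
  filter_upwards [hae] with U hU
  exact (iUnion_obstacle_subset hc (hsee _ U hU)).trans
    (Set.iUnion_mono fun k => obstacle_openOutside_subset _)

/-- The union of the obstacles is dominated by the union of the obstacles in independent
environments. -/
theorem stochDominatedBy_iUnion_obstacle :
    StochDominatedBy (fun σ : Config d => ⋃ y : EvenSite d, obstacle σ y) (Measure.infinitePi β)
      (fun U : EvenSite d × Site d → Bool => ⋃ y : EvenSite d, obstacle (fun x => U (y, x)) y)
      (Measure.infinitePi fun q : EvenSite d × Site d => β q.2) := by
  classical
  have : Nonempty (EvenSite d) := ⟨⟨0, by simp⟩⟩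
  -- Repetitions in `f` are harmless: for a fixed `v` the coupling still reads one copy at each
  -- site.
  obtain ⟨f, hf⟩ := exists_surjective_nat (EvenSite d)
  obtain ⟨g, hg⟩ := exists_surjective_nat (Site d)
  let S : ℕ → Finset (Site d) := fun n => (Finset.range n).image g
  have hS : Monotone S := fun m n h => Finset.image_mono _ (Finset.range_mono h)
  have hS' : ∀ F : Finset (Site d), ∃ n, F ⊆ S n := fun F => by
    choose h hh using hg
    refine ⟨F.sup h + 1, fun x hx => Finset.mem_image.2 ⟨h x, ?_, hh x⟩⟩
    exact Finset.mem_range.2 (Nat.lt_succ_of_le (Finset.le_sup hx))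
  let B : ℕ → Config d → Set (Site d) := fun n σ =>
    ⋃ k : Fin (n + 1), obstacle (openOutside (S n) σ) (f k)
  have hUB : (fun σ : Config d => ⋃ y : EvenSite d, obstacle σ y) = fun σ => ⋃ n, B n σ := by
    funext σ
    refine Set.Subset.antisymm (Set.iUnion_subset fun y z hz => ?_) (Set.iUnion_subset fun n =>
      Set.iUnion_subset fun k => (obstacle_openOutside_subset _).trans
        (Set.subset_iUnion (fun y => obstacle σ y) _))
    obtain ⟨i, rfl⟩ := hf y
    obtain ⟨F, hF⟩ := exists_mem_obstacle_openOutside hz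
    obtain ⟨n, hn⟩ := hS' F
    refine Set.mem_iUnion.2 ⟨max i n, Set.mem_iUnion.2 ⟨⟨i, by omega⟩, ?_⟩⟩
    exact obstacle_openOutside_mono (hn.trans (hS (le_max_right _ _))) _ hF
  rw [hUB]
  choose φ hφ hmap hae using fun n => exists_coupling_of_finite β (S n) fun k : Fin (n + 1) => f k
  have hob : ∀ n, Measurable fun v : S n → Bool => ⋃ k : Fin (n + 1),
    obstacle (extendOpen (S n) v) (f k) := fun n => Measurable.of_discrete
  refine stochDominatedBy_iUnion
    (C := fun n U => ⋃ k : Fin (n + 1), obstacle (extendOpen (S n) (φ n U)) (f k))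
    (fun n => measurable_openOutside_of_any fun σ => ⋃ k : Fin (n + 1), obstacle σ (f k))
    (fun σ m n hmn => ?_) (fun n => (hob n).comp (hφ n)) (fun n => ?_) ?_ fun n => ?_
  · refine Set.iUnion_subset fun k => Set.Subset.trans ?_
      (Set.subset_iUnion _ ⟨k, by omega⟩)
    exact obstacle_openOutside_mono (hS hmn) _
  · have h1 := Measure.map_map (μ := Measure.infinitePi fun q : EvenSite d × Site d => β q.2)
      (hob n) (hφ n)
    have h2 := Measure.map_map (μ := Measure.infinitePi β) (hob n) measurable_restrict_sites
    rw [hmap n, h2] at h1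
    refine Eq.trans ?_ h1
    congr 1
  · exact measurable_iUnion_set fun y => (measurable_obstacle y).comp
      (measurable_pi_iff.2 fun x => measurable_pi_apply _)
  · filter_upwards [hae n] with U hU
    exact hU.trans (Set.iUnion_subset fun k =>
      Set.subset_iUnion (fun y => obstacle (fun x => U (y, x)) y) _)

end Domination

theorem mainTheorem7 (d : ℕ) (_hd : 2 ≤ d) (p : ℝ) (_hp : p ∈ Set.Icc (0 : ℝ) 1)
    -- site percolation with parameter `p` on `ℤ^d`
    {Ω : Type*} [MeasurableSpace Ω] (μ : Measure Ω) [IsProbabilityMeasure μ]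
    (X : Site d → Ω → Bool) (_hXmeas : ∀ x, Measurable (X x)) (_hXindep : iIndepFun X μ)
    (_hXlaw : ∀ x, μ {ω | X x ω = true} = ENNReal.ofReal p)
    -- independent copies of the obstacles
    {Ω' : Type*} [MeasurableSpace Ω'] (μ' : Measure Ω') [IsProbabilityMeasure μ']
    (A' : EvenSite d → Ω' → Set (Site d)) (_hA'meas : ∀ y, AEMeasurable (A' y) μ')
    (_hA'indep : iIndepFun A' μ')
    (_hA'law : ∀ y, μ'.map (A' y) = μ.map (fun ω => obstacle (fun x => X x ω) y)) :
    (∀ y, Measurable fun ω => obstacle (fun x => X x ω) y) ∧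
    (∀ ω, badSites (fun x => X x ω) = ⋃ y : EvenSite d, obstacle (fun x => X x ω) y) ∧
    StochDominatedBy (fun ω => ⋃ y : EvenSite d, obstacle (fun x => X x ω) y) μ
      (fun ω' => ⋃ y : EvenSite d, A' y ω') μ' := by
  have hX : Measurable fun ω x => X x ω := measurable_pi_iff.2 _hXmeas
  have hob : ∀ y, Measurable fun ω => obstacle (fun x => X x ω) y := fun y =>
    (measurable_obstacle y).comp hX
  refine ⟨hob, fun ω => badSites_eq_iUnion_obstacle, ?_⟩
  have hprob : ∀ x, IsProbabilityMeasure (μ.map (X x)) := fun x =>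
    Measure.isProbabilityMeasure_map (_hXmeas x).aemeasurable
  have hlaw : μ.map (fun ω x => X x ω) = Measure.infinitePi fun x => μ.map (X x) :=
    _hXindep.map_fun_eq_infinitePi_map _hXmeas
  have hcopy : ∀ y : EvenSite d, Measurable fun (U : EvenSite d × Site d → Bool) (x : Site d) =>
    U (y, x) := fun y => measurable_pi_iff.2 fun x => measurable_pi_apply _
  have hU : Measurable fun s : EvenSite d → Set (Site d) => ⋃ y, s y :=
    measurable_iUnion_set fun y => measurable_pi_apply y
  have hA' : AEMeasurable (fun ω' y => A' y ω') μ' := aemeasurable_pi_iff.2 _hA'meas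
  refine (stochDominatedBy_iUnion_obstacle fun x => μ.map (X x)).congr
    ⟨(measurable_iUnion_set measurable_obstacle).aemeasurable,
      (measurable_iUnion_set hob).aemeasurable, ?_⟩
    ⟨(measurable_iUnion_set fun y => (measurable_obstacle y).comp (hcopy y)).aemeasurable,
      hU.comp_aemeasurable hA', ?_⟩
  · rw [← hlaw, Measure.map_map (measurable_iUnion_set measurable_obstacle) hX]
    rfl
  -- Independence and the marginal laws determine the joint law, so the given copies may be replaced
  -- by obstacles in independent environments.
  · have h1 : μ'.map (fun ω' y => A' y ω') = (Measure.infinitePi fun q : EvenSite d × Site d =>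
        μ.map (X q.2)).map fun U y => obstacle (fun x => U (y, x)) y := by
      have hprob' : IsProbabilityMeasure (μ.map fun ω x => X x ω) :=
        Measure.isProbabilityMeasure_map hX.aemeasurable
      have h2 := Measure.infinitePi_map_curry fun (_ : EvenSite d) (x : Site d) => μ.map (X x)
      have h3 := Measure.infinitePi_map_pi (fun _ : EvenSite d => μ.map fun ω x => X x ω)
        measurable_obstacle
      rw [← hlaw] at h2
      have hobs : Measurable fun (V : EvenSite d → Config d) y => obstacle (V y) y :=
        measurable_pi_iff.2 fun y => (measurable_obstacle y).comp (measurable_pi_apply y)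
      rw [← h2, Measure.map_map hobs (MeasurableEquiv.measurable _)] at h3
      refine (_hA'indep.map_fun_eq_infinitePi_map₀' _hA'meas).trans (Eq.trans ?_ h3.symm)
      congr 1
      funext y
      rw [_hA'law, Measure.map_map (measurable_obstacle y) hX]
      rfl
    refine Eq.trans ?_ (AEMeasurable.map_map_of_aemeasurable hU.aemeasurable hA')
    rw [h1]
    have hobs : Measurable fun (U : EvenSite d × Site d → Bool) y => obstacle (fun x => U (y, x)) y :=
      measurable_pi_iff.2 fun y => (measurable_obstacle y).comp (hcopy y)
    exact (Measure.map_map hU hobs).symm
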